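/- **Setting.** A firm has $b$ identical units to sell over $n\ge 3$ periods, $1\le b\le n$. Let $0<a<1$ and $0<p<1$. An adversary fixes an initial sequence $\vec v_I=(v_{I,1},\dots,v_{I,n})\in\{0,a,1\}^n$, where $1$ (resp. $a$) is a type-1 (resp. type-2) customer, who demands one unit and generates that revenue if accepted, and $0$ means that no customer arrives. Every index $j\in\{1,\dots,n\}$ joins the stochastic group $\mathcal S$ independently with probability $p$; given $\mathcal S$, a permutation $\sigma$ of $\mathcal S$ is drawn uniformly at random. The realized arrival sequence $\vec V=(V_1,\dots,V_n)$ is given by $V_{\sigma(j)}=v_{I,j}$ for $j\in\mathcal S$ and $V_j=v_{I,j}$ for $j\notin\mathcal S$. Let $OPT(\vec v)$ be the optimum offline revenue, i.e. the maximal total revenue of at most $b$ customers of $\vec v$. An online algorithm with revenue $ALG$ is $c$-competitive in this partially predictable model if $\mathbb E[ALG(\vec V)]\ge c\,OPT(\vec v_I)$ for every $\vec v_I\in\{0,a,1\}^n$. **Algorithm 1.** Put $\theta=\frac{1-p}{2-a}$ and start with counters $q_1=q_{2,e}=q_{2,f}=0$. At each time $\lambda=1/n,2/n,\dots,1$, if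 there is remaining inventory ($q_1+q_{2,e}+q_{2,f}<b$), treat the customer $v_i$ arriving in period $i=\lambda n$ as follows. * If $v_i=1$, accept and increase $q_1$ by one. * If $v_i=a$ and $q_1+q_{2,e}<\lfloor\lambda pb\rfloor$, accept and increase $q_{2,e}$ by one (evolving threshold rule). * If $v_i=a$, the evolving threshold rule does not apply, and $q_{2,f}<\lfloor\theta b\rfloor$, accept and increase $q_{2,f}$ by one (fixed threshold rule). In all other cases nothing is accepted. The revenue is $ALG_1=q_1+a\,(q_{2,e}+q_{2,f})$ with the final values of the counters. **Theorem.** There is an absolute constant $K>0$ such that for all integers $n\ge 3$ and $1\le b\le n$ and all $a,p\in(0,1)$, Algorithm 1 is $c$-competitive in the partially predictable model with $$c=p+\frac{1-p}{2-a}-K\cdot\frac{1}{a(1-p)p}\sqrt{\frac{\log n}{b}} .$$ -/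

import Mathlib

namespace PartiallyPredictable

/-- What arrives in one period: nobody, a type-1 customer, or a type-2 customer. -/
inductive Customer where
  | none
  | type1
  | type2
  deriving DecidableEq

/-- The revenue generated by a customer if accepted: `0`, `1` or `a`. -/
def Customer.value (a : ℝ) : Customer → ℝ
  | .none => 0
  | .type1 => 1
  | .type2 => a

/-- A sequence of arrivals over `n` periods; period `i + 1` of the horizon is the index
`i : Fin n`. -/
abbrev Instance (n : ℕ) : Type := Fin n → Customer

/-- Number of type-1 customers. -/
def numType1 {n : ℕ} (v : Instance n) : ℕ := (Finset.univ.filter fun i => v i = .type1).card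

/-- Number of type-2 customers. -/
def numType2 {n : ℕ} (v : Instance n) : ℕ := (Finset.univ.filter fun i => v i = .type2).card

/-- The optimum offline (clairvoyant) revenue: the largest total revenue of a set of at most `b`
arriving customers. -/
noncomputable def opt {n : ℕ} (b : ℕ) (a : ℝ) (v : Instance n) : ℝ :=
  (Finset.univ.filter fun A : Finset (Fin n) => A.card ≤ b).sup' ⟨∅, by simp⟩
    fun A => ∑ i ∈ A, (v i).value a

/-- The optimum offline solution accepts as many type-1 customers as possible and fills the rest of
the inventory with type-2 customers (the subtraction is truncated: it is `(b - n₁)⁺`). -/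
theorem opt_eq {n : ℕ} (b : ℕ) (a : ℝ) (h0 : 0 < a) (h1 : a < 1) (v : Instance n) :
    opt b a v = (min b (numType1 v) : ℕ) + a * (min (numType2 v) (b - numType1 v) : ℕ) := by
  have hsum : ∀ A : Finset (Fin n), ∑ i ∈ A, (v i).value a =
      ((A.filter fun i => v i = .type1).card : ℝ) + a * ((A.filter fun i => v i = .type2).card : ℝ) := by
    intro A
    rw [Finset.card_filter, Finset.card_filter]
    push_cast
    rw [Finset.mul_sum, ← Finset.sum_add_distrib]
    refine Finset.sum_congr rfl fun i _ => ?_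
    cases h : v i <;> simp [Customer.value]
  apply le_antisymm
  · unfold opt
    apply Finset.sup'_le
    intro A hA
    rw [hsum]
    simp only [Finset.mem_filter, Finset.mem_univ, true_and] at hA
    have e1 : (A.filter fun i => v i = .type1).card ≤ numType1 v :=
      Finset.card_le_card (Finset.filter_subset_filter _ (Finset.subset_univ A))
    have e2 : (A.filter fun i => v i = .type2).card ≤ numType2 v :=
      Finset.card_le_card (Finset.filter_subset_filter _ (Finset.subset_univ A))
    have e3 : (A.filter fun i => v i = .type1).card + (A.filter fun i => v i = .type2).card ≤ A.card := by
      rw [← Finset.card_union_of_disjoint]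
      · exact Finset.card_le_card (by intro i; simp; tauto)
      · rw [Finset.disjoint_filter]; intro i _ h; simp [h]
    generalize (A.filter fun i => v i = .type1).card = x at *
    generalize (A.filter fun i => v i = .type2).card = y at *
    have hx : x ≤ min b (numType1 v) := by omega
    have hy : y ≤ min (numType2 v) (b - numType1 v) + (min b (numType1 v) - x) := by omega
    obtain ⟨d, hd⟩ := Nat.exists_eq_add_of_le hx
    have hy' : (y : ℝ) ≤ (min (numType2 v) (b - numType1 v) : ℕ) + d := by
      have : y ≤ min (numType2 v) (b - numType1 v) + d := by omega
      exact_mod_cast this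
    rw [hd]
    push_cast at hy' ⊢
    have hd0 : (0:ℝ) ≤ d := by positivity
    nlinarith
  · obtain ⟨A, hA, hAc⟩ := Finset.exists_subset_card_eq (s := Finset.univ.filter fun i => v i = .type1) (n := min b (numType1 v)) (by unfold numType1; omega)
    obtain ⟨B, hB, hBc⟩ := Finset.exists_subset_card_eq (s := Finset.univ.filter fun i => v i = .type2) (n := min (numType2 v) (b - numType1 v)) (by unfold numType2; omega)
    have hd : Disjoint A B := Finset.disjoint_of_subset_left hA (Finset.disjoint_of_subset_right hB (by rw [Finset.disjoint_filter]; intro i _ h; simp [h]))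
    have hm : A ∪ B ∈ (Finset.univ.filter fun A : Finset (Fin n) => A.card ≤ b) := by
      simp [Finset.card_union_of_disjoint hd, hAc, hBc]; omega
    refine le_trans (le_of_eq ?_) (Finset.le_sup' (fun A : Finset (Fin n) => ∑ i ∈ A, (v i).value a) hm)
    rw [Finset.sum_union hd,
      Finset.sum_congr rfl (g := fun _ => (1:ℝ)) (fun i hi => by
        have := hA hi; simp at this; simp [this, Customer.value]),
      Finset.sum_congr (s₁ := B) rfl (g := fun _ => a) (fun i hi => by
        have := hB hi; simp at this; simp [this, Customer.value])]
    simp [hAc, hBc, mul_comm]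

/-- The counters of the algorithm: accepted type-1 customers, type-2 customers accepted by the
evolving threshold, type-2 customers accepted by the fixed threshold. -/
structure Counters where
  q₁ : ℕ
  q₂e : ℕ
  q₂f : ℕ

/-- One step of the non-adaptive algorithm, in period `t ∈ {1, …, n}`, that is at normalized time
`λ = t / n`, when `c` arrives. -/
noncomputable def step (n b : ℕ) (a p : ℝ) (t : ℕ) (c : Customer) (q : Counters) : Counters :=
  if q.q₁ + q.q₂e + q.q₂f < b then
    match c with
    | .none => q
    | .type1 => { q with q₁ := q.q₁ + 1 }
    | .type2 =>
      if q.q₁ + q.q₂e < ⌊(t : ℝ) / n * p * b⌋₊ then { q with q₂e := q.q₂e + 1 }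
      else if q.q₂f < ⌊(1 - p) / (2 - a) * b⌋₊ then { q with q₂f := q.q₂f + 1 }
      else q
  else q

/-- The counters after the first `t` periods. -/
noncomputable def counters {n : ℕ} (b : ℕ) (a p : ℝ) (v : Instance n) : ℕ → Counters
  | 0 => ⟨0, 0, 0⟩
  | t + 1 =>
    if h : t < n then step n b a p (t + 1) (v ⟨t, h⟩) (counters b a p v t)
    else counters b a p v t

/-- The revenue of the non-adaptive algorithm on the realized arrival sequence `v`. -/
noncomputable def alg {n : ℕ} (b : ℕ) (a p : ℝ) (v : Instance n) : ℝ :=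
  (counters b a p v n).q₁ + a * ((counters b a p v n).q₂e + (counters b a p v n).q₂f)

/-- The realized arrival sequence, when the stochastic group is `S` and its members are permuted by
`σ`: the customer `j ∈ S` arrives in period `σ j`, every other customer in its own period. -/
def arrival {n : ℕ} (v : Instance n) (S : Finset (Fin n)) (σ : Equiv.Perm {i // i ∈ S}) :
    Instance n :=
  fun i => v ((Equiv.Perm.ofSubtype σ).symm i)

/-- The expectation `E[f(V)]` in the partially predictable model with initial sequence `v`: every
customer joins the stochastic group `S` independently with probability `p`, and the permutation of
`S` is uniformly random. -/
noncomputable def expect {n : ℕ} (p : ℝ) (v : Instance n) (f : Instance n → ℝ) : ℝ :=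
  ∑ S : Finset (Fin n), p ^ S.card * (1 - p) ^ (n - S.card) *
    ((∑ σ : Equiv.Perm {i // i ∈ S}, f (arrival v S σ)) / (S.card.factorial : ℝ))

/-- A (deterministic) algorithm, given by its revenue on every realized arrival sequence, is
`c`-competitive in the partially predictable model with horizon `n` and inventory `b`. -/
def IsCompetitive (n b : ℕ) (a p : ℝ) (revenue : Instance n → ℝ) (c : ℝ) : Prop :=
  ∀ v : Instance n, c * opt b a v ≤ expect p v revenue

end PartiallyPredictable

/-!
Only the case in which the error term is below `1` matters, and then `log n ≤ b`. Write
`θ = (1 - p) / (2 - a)`, and let `n₁`, `n₂` be the numbers of customers of the two types.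

*Probability.* Fix a set `T` of at most `b` customers and a set `W` of periods. With probability
`1 - O(n⁻³)` at least `p |T| |W| / n - O(√(b log n) / p)` customers of `T` arrive in `W`
(`landed_ge_of_penalty_lt_one`, `avg_penalty_le`); it suffices to count the members of the
stochastic group `S`. Indeed `|S|`, `|S ∩ W|`, `|S ∩ T|` are binomial, and given `S` the number of
members of `S ∩ T` that are sent to `S ∩ W` is hypergeometric. The latter has the exponential
moments of the binomial variable with the same mean, because a uniform permutation of a set of
size `k` maps `A` into `U` with probability at most `(|U| / k) ^ |A|` (`sum_perm_pow_le`). Taking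
`|T| ≤ b` is what makes the deviation scale with `b` rather than with `n`. The failure
probabilities are carried as a sum of exponentials (`penalty`) that is at least `1` on the bad event,
so that a pointwise inequality for the revenue can simply be averaged.

*The algorithm.* On the good event there are two cases, according to whether the inventory
is exhausted at the end.

If it is not (`revenue_of_unsold`), all type-1 customers are accepted. If a type-2 customer is
rejected, the fixed threshold is used up, and at the last rejection, in period `s`, the counters
satisfy `q₁ + q₂e ≥ ⌊(s / n) p b⌋`. From then on everybody is accepted outside the fixed
threshold, and among any `M = min b (n₁ + n₂)` customers about `p (1 - s / n) M` arrive after `s`.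
Hence `q₁ + q₂e ≥ p M` up to the deviation, while the optimum is `(1 - a) n₁ + a M`.

If it is (`revenue_of_sold_out`), let `s` be the last period in which the evolving threshold rule
was applied. Then `q₂e` plus the number of type-1 arrivals up to `s` is at most `(s / n) p b`, so
`q₂e ≤ p (b - n₁)⁺` up to the deviation, and `q₂f ≤ θ b`. The revenue is
`b - (1 - a) (q₂e + q₂f)`, and `θ` is chosen such that the resulting affine inequality
in `min b n₁` is tight when `n₁ ≥ b`.

In each case either there is no loss at all or the optimum is at least of the order of
`a (1 - p) b`, which turns the additive loss `O(√(b log n) / p)` into the stated ratio.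
-/

namespace PartiallyPredictable

open Finset

/-! ### Random permutations and exponential moments -/

section Perm

variable {α : Type*} [Fintype α] [DecidableEq α]

theorem card_perm_insert_eq (U A : Finset α) {x y : α} (hx : x ∉ A) (hy : y ∉ A) :
    (univ.filter fun σ : Equiv.Perm α => (∀ j ∈ A, σ j ∈ U) ∧ σ x ∈ U).card =
      (univ.filter fun σ : Equiv.Perm α => (∀ j ∈ A, σ j ∈ U) ∧ σ y ∈ U).card := by
  have hA : ∀ j ∈ A, Equiv.swap x y j = j := fun j hj =>
    Equiv.swap_apply_of_ne_of_ne (fun h => hx (h ▸ hj)) (fun h => hy (h ▸ hj))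
  refine card_bij (fun σ _ => σ * Equiv.swap x y) ?_ (fun σ _ τ _ h => mul_right_cancel h) ?_
  · intro σ hσ
    simp only [mem_filter, mem_univ, true_and, Equiv.Perm.mul_apply, Equiv.swap_apply_right]
      at hσ ⊢
    exact ⟨fun j hj => by rw [hA j hj]; exact hσ.1 j hj, hσ.2⟩
  · intro σ hσ
    simp only [mem_filter, mem_univ, true_and] at hσ
    refine ⟨σ * Equiv.swap x y, ?_, by simp [mul_assoc]⟩
    simp only [mem_filter, mem_univ, true_and, Equiv.Perm.mul_apply, Equiv.swap_apply_left]
    exact ⟨fun j hj => by rw [hA j hj]; exact hσ.1 j hj, hσ.2⟩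

/-- Given that a uniformly random permutation maps `A` into `U`, it maps a further point into `U`
with probability `(|U| - |A|) / (|α| - |A|)`, which is at most `|U| / |α|`. -/
theorem card_perm_insert_le (U A : Finset α) {x : α} (hx : x ∉ A) :
    Fintype.card α * (univ.filter fun σ : Equiv.Perm α => (∀ j ∈ A, σ j ∈ U) ∧ σ x ∈ U).card ≤
      U.card * (univ.filter fun σ : Equiv.Perm α => ∀ j ∈ A, σ j ∈ U).card := by
  set N := (univ.filter fun σ : Equiv.Perm α => ∀ j ∈ A, σ j ∈ U).card with hN
  set N' := (univ.filter fun σ : Equiv.Perm α => (∀ j ∈ A, σ j ∈ U) ∧ σ x ∈ U).card with hN'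
  have hle : N' ≤ N := card_le_card fun σ => by simp +contextual
  have hUA : U.card ≤ Fintype.card α := card_le_univ U
  -- double count the pairs `(y, σ)` with `y ∉ A`, `σ A ⊆ U` and `σ y ∈ U`
  have key : Fintype.card α * N' + A.card * N = A.card * N' + U.card * N := by
    have h1 : ∑ y ∈ Aᶜ, (univ.filter fun σ : Equiv.Perm α =>
        (∀ j ∈ A, σ j ∈ U) ∧ σ y ∈ U).card = Aᶜ.card * N' := by
      rw [← smul_eq_mul, ← sum_const]
      exact sum_congr rfl fun y hy => card_perm_insert_eq U A (mem_compl.1 hy) hx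
    have h2 : ∑ y ∈ A, (univ.filter fun σ : Equiv.Perm α =>
        (∀ j ∈ A, σ j ∈ U) ∧ σ y ∈ U).card = A.card * N := by
      rw [← smul_eq_mul, ← sum_const]
      refine sum_congr rfl fun y hy => ?_
      rw [hN]
      congr 1
      ext σ
      simp only [mem_filter, mem_univ, true_and, and_iff_left_iff_imp]
      exact fun h => h y hy
    have h3 : ∑ y, (univ.filter fun σ : Equiv.Perm α =>
        (∀ j ∈ A, σ j ∈ U) ∧ σ y ∈ U).card = U.card * N := by
      have : ∀ y, (univ.filter fun σ : Equiv.Perm α => (∀ j ∈ A, σ j ∈ U) ∧ σ y ∈ U).card =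
          ∑ σ ∈ univ.filter fun σ : Equiv.Perm α => ∀ j ∈ A, σ j ∈ U,
            if σ y ∈ U then 1 else 0 := fun y => by
        rw [← filter_filter, card_filter]
      simp_rw [this]
      rw [sum_comm, mul_comm, ← smul_eq_mul, ← sum_const]
      refine sum_congr rfl fun σ _ => ?_
      rw [← card_filter]
      refine card_bij (fun y _ => σ y) (fun y hy => by simpa using hy)
        (fun _ _ _ _ h => σ.injective h) (fun z hz => ⟨σ.symm z, by simpa using hz, by simp⟩)
    have h4 := sum_compl_add_sum A fun y => (univ.filter fun σ : Equiv.Perm α =>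
        (∀ j ∈ A, σ j ∈ U) ∧ σ y ∈ U).card
    rw [h1, h2, h3] at h4
    have h5 : Aᶜ.card + A.card = Fintype.card α := by rw [add_comm]; exact card_add_card_compl A
    rw [← h5, ← h4]; ring
  have : A.card * N' ≤ A.card * N := Nat.mul_le_mul_left _ hle
  omega

theorem card_perm_le (U A : Finset α) :
    ((univ.filter fun σ : Equiv.Perm α => ∀ j ∈ A, σ j ∈ U).card : ℝ) ≤
      (Fintype.card α).factorial * ((U.card : ℝ) / Fintype.card α) ^ A.card := by
  induction A using Finset.induction_on with
  | empty => simp [Fintype.card_perm]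
  | insert x A hx ih =>
    have hk : (0 : ℝ) < Fintype.card α := by exact_mod_cast Fintype.card_pos_iff.2 ⟨x⟩
    have h := card_perm_insert_le U A hx
    have h' : (Fintype.card α : ℝ) *
        (univ.filter fun σ : Equiv.Perm α => (∀ j ∈ A, σ j ∈ U) ∧ σ x ∈ U).card ≤
        U.card * (univ.filter fun σ : Equiv.Perm α => ∀ j ∈ A, σ j ∈ U).card := by
      exact_mod_cast h
    have e : (univ.filter fun σ : Equiv.Perm α => ∀ j ∈ insert x A, σ j ∈ U) =
        univ.filter fun σ : Equiv.Perm α => (∀ j ∈ A, σ j ∈ U) ∧ σ x ∈ U := by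
      ext σ; simp [and_comm]
    rw [e, card_insert_of_notMem hx, pow_succ]
    calc _ ≤ (U.card : ℝ) / Fintype.card α *
          (univ.filter fun σ : Equiv.Perm α => ∀ j ∈ A, σ j ∈ U).card := by
            rw [div_mul_eq_mul_div, le_div_iff₀ hk]; linarith
      _ ≤ (U.card : ℝ) / Fintype.card α *
          ((Fintype.card α).factorial * ((U.card : ℝ) / Fintype.card α) ^ A.card) := by gcongr
      _ = _ := by ring

/-- The moment generating function of a hypergeometric variable is at most that of the binomial
variable with the same mean and number of draws. -/
theorem sum_perm_pow_le (M U : Finset α) {y : ℝ} (hy : 0 ≤ y) :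
    ∑ σ : Equiv.Perm α, (1 + y) ^ (M.filter fun j => σ j ∈ U).card ≤
      (Fintype.card α).factorial * (1 + y * (U.card / Fintype.card α)) ^ M.card := by
  have expand : ∀ σ : Equiv.Perm α, (1 + y) ^ (M.filter fun j => σ j ∈ U).card =
      ∑ A ∈ M.powerset, y ^ A.card * if ∀ j ∈ A, σ j ∈ U then 1 else 0 := by
    intro σ
    rw [add_comm, ← prod_const, prod_filter]
    have : ∀ j, (if σ j ∈ U then y + 1 else 1) = (if σ j ∈ U then y else 0) + 1 := fun j => by
      split_ifs <;> simp
    simp_rw [this]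
    rw [prod_add]
    refine sum_congr rfl fun A _ => ?_
    rw [prod_const_one, mul_one]
    split_ifs with h
    · rw [prod_congr rfl fun j hj => if_pos (h j hj), prod_const, mul_one]
    · push Not at h
      obtain ⟨j, hj, hU⟩ := h
      rw [prod_eq_zero hj (if_neg hU), mul_zero]
  simp_rw [expand]
  rw [sum_comm]
  calc _ ≤ ∑ A ∈ M.powerset, y ^ A.card *
        ((Fintype.card α).factorial * ((U.card : ℝ) / Fintype.card α) ^ A.card) := by
        refine sum_le_sum fun A _ => ?_
        rw [← mul_sum]
        refine mul_le_mul_of_nonneg_left ?_ (by positivity)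
        rw [sum_boole]
        exact card_perm_le U A
    _ = _ := by
        have h := sum_pow_mul_eq_add_pow (y * ((U.card : ℝ) / Fintype.card α)) 1 M
        rw [add_comm 1, ← h, mul_sum]
        refine sum_congr rfl fun A _ => ?_
        rw [one_pow, mul_one, mul_pow]; ring

theorem exp_le_one_add_add_sq {x : ℝ} (hx : |x| ≤ 1) : Real.exp x ≤ 1 + x + x ^ 2 := by
  have := (abs_le.1 (Real.abs_exp_sub_one_sub_id_le hx)).2
  linarith

theorem sum_perm_exp_le (M U : Finset α) {s : ℝ} (h0 : 0 ≤ s) (h1 : s ≤ 1) :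
    (∑ σ : Equiv.Perm α, Real.exp (s * (M.filter fun j => σ j ∈ U).card)) /
        (Fintype.card α).factorial ≤
      Real.exp (M.card * (U.card / Fintype.card α) * s + M.card * s ^ 2) := by
  have hf : (0 : ℝ) < (Fintype.card α).factorial := by positivity
  have hy : 0 ≤ Real.exp s - 1 := by linarith [Real.add_one_le_exp s]
  set q : ℝ := (U.card : ℝ) / Fintype.card α with hq
  have hq0 : 0 ≤ q := by positivity
  have hq1 : q ≤ 1 := div_le_one_of_le₀ (by exact_mod_cast card_le_univ U) (by positivity)
  have h := sum_perm_pow_le M U hy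
  rw [add_sub_cancel] at h
  rw [div_le_iff₀ hf, mul_comm]
  refine le_trans (le_of_eq (sum_congr rfl fun σ _ => ?_)) (h.trans ?_)
  · rw [mul_comm, Real.exp_nat_mul]
  · refine mul_le_mul_of_nonneg_left ?_ hf.le
    calc (1 + (Real.exp s - 1) * q) ^ M.card ≤ Real.exp (q * s + s ^ 2) ^ M.card := by
          refine pow_le_pow_left₀ (by positivity) ?_ _
          have e1 := exp_le_one_add_add_sq (x := s) (by rw [abs_of_nonneg h0]; exact h1)
          have e2 := Real.add_one_le_exp (q * s + s ^ 2)
          nlinarith [sq_nonneg s]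
      _ = _ := by rw [← Real.exp_nat_mul]; congr 1; ring

end Perm

/-! ### The expectation over the stochastic group and its permutation -/

variable {n : ℕ}

/-- The expectation of a function of the stochastic group `S` and of the permutation of `S`; by
definition `expect p v f = avg p fun S σ => f (arrival v S σ)`. -/
noncomputable def avg (p : ℝ) (F : (S : Finset (Fin n)) → Equiv.Perm {i // i ∈ S} → ℝ) : ℝ :=
  ∑ S : Finset (Fin n), p ^ S.card * (1 - p) ^ (n - S.card) *
    ((∑ σ : Equiv.Perm {i // i ∈ S}, F S σ) / (S.card.factorial : ℝ))

theorem avg_mono {p : ℝ} (h0 : 0 ≤ p) (h1 : p ≤ 1)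
    {F G : (S : Finset (Fin n)) → Equiv.Perm {i // i ∈ S} → ℝ} (h : ∀ S σ, F S σ ≤ G S σ) :
    avg p F ≤ avg p G := by
  have : 0 ≤ 1 - p := by linarith
  refine sum_le_sum fun S _ => mul_le_mul_of_nonneg_left ?_ (by positivity)
  exact div_le_div_of_nonneg_right (sum_le_sum fun σ _ => h S σ) (by positivity)

theorem avg_add (p : ℝ) (F G : (S : Finset (Fin n)) → Equiv.Perm {i // i ∈ S} → ℝ) :
    avg p (fun S σ => F S σ + G S σ) = avg p F + avg p G := by
  simp only [avg, sum_add_distrib, add_div, mul_add]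

theorem avg_mul (p r : ℝ) (F : (S : Finset (Fin n)) → Equiv.Perm {i // i ∈ S} → ℝ) :
    avg p (fun S σ => r * F S σ) = r * avg p F := by
  simp only [avg, ← mul_sum, mul_div_assoc]
  rw [mul_sum]
  exact sum_congr rfl fun S _ => by ring

theorem avg_sum {ι : Type*} (p : ℝ) (I : Finset ι)
    (F : ι → (S : Finset (Fin n)) → Equiv.Perm {i // i ∈ S} → ℝ) :
    avg p (fun S σ => ∑ i ∈ I, F i S σ) = ∑ i ∈ I, avg p (F i) := by
  simp only [avg]
  rw [sum_comm]
  refine sum_congr rfl fun S _ => ?_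
  rw [sum_comm, sum_div, mul_sum]

theorem avg_of_forall (p : ℝ) (f : Finset (Fin n) → ℝ) :
    avg p (fun S _ => f S) = ∑ S, p ^ S.card * (1 - p) ^ (n - S.card) * f S := by
  refine sum_congr rfl fun S _ => ?_
  rw [sum_const, nsmul_eq_mul, card_univ, Fintype.card_perm, Fintype.card_coe,
    mul_div_cancel_left₀ _ (by positivity)]

/-- The moment generating function of the number `|S ∩ X|`, which is binomial. -/
theorem avg_exp_inter (p s : ℝ) (X : Finset (Fin n)) :
    avg p (fun S _ => Real.exp (s * (S ∩ X).card)) = (1 - p + p * Real.exp s) ^ X.card := by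
  rw [avg_of_forall]
  have h := prod_add (fun i : Fin n => p * if i ∈ X then Real.exp s else 1) (fun _ => 1 - p) univ
  have e : ∀ i : Fin n, (p * (if i ∈ X then Real.exp s else 1) + (1 - p)) =
      if i ∈ X then 1 - p + p * Real.exp s else 1 := fun i => by split_ifs <;> ring
  simp_rw [e] at h
  rw [← prod_filter, prod_const, filter_mem_eq_inter, univ_inter] at h
  rw [h, powerset_univ]
  refine sum_congr rfl fun S _ => ?_
  rw [prod_mul_distrib, prod_const, prod_const, ← prod_filter, prod_const, filter_mem_eq_inter,
    mul_comm s, Real.exp_nat_mul, card_univ_sdiff, Fintype.card_fin]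
  ring

theorem avg_const (p r : ℝ) : avg (n := n) p (fun _ _ => r) = r := by
  have h := avg_exp_inter (n := n) p 0 ∅
  have h' := avg_mul (n := n) p r (fun _ _ => 1)
  simp at h
  rw [h] at h'
  simpa using h'

theorem avg_exp_inter_le {p s : ℝ} (h0 : 0 ≤ p) (h1 : p ≤ 1) (hs : |s| ≤ 1) (X : Finset (Fin n)) :
    avg p (fun S _ => Real.exp (s * (S ∩ X).card)) ≤ Real.exp (X.card * (p * s + s ^ 2)) := by
  rw [avg_exp_inter, Real.exp_nat_mul]
  refine pow_le_pow_left₀ (by have := Real.exp_pos s; nlinarith) ?_ _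
  have e1 := exp_le_one_add_add_sq hs
  have e2 := Real.add_one_le_exp (p * s + s ^ 2)
  nlinarith [sq_nonneg s]

/-- The deviation `4 √(N log n)` of the Chernoff bounds below has probability at most `n⁻³`: the
optimal exponent is of the order `s = √(log n / N)`. -/
theorem exp_deviation_le {N : ℝ} {x : ℝ} (hn : 0 < n) (hN : 0 < N) (hx : x ≤ N) :
    Real.exp (x * √(Real.log n / N) ^ 2 - √(Real.log n / N) * (4 * √(N * Real.log n))) ≤
      ((n : ℝ) ^ 3)⁻¹ := by
  have hn' : (0 : ℝ) < n := by exact_mod_cast hn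
  have hL : 0 ≤ Real.log n := Real.log_natCast_nonneg n
  have e1 : √(Real.log n / N) ^ 2 = Real.log n / N := Real.sq_sqrt (by positivity)
  have e2 : √(Real.log n / N) * (4 * √(N * Real.log n)) = 4 * Real.log n := by
    rw [mul_left_comm, ← Real.sqrt_mul (by positivity)]
    rw [show Real.log n / N * (N * Real.log n) = Real.log n ^ 2 by field_simp, Real.sqrt_sq hL]
  have e3 : x * (Real.log n / N) ≤ Real.log n := by
    rw [← mul_div_assoc, div_le_iff₀ hN]; nlinarith
  rw [e1, e2]
  calc _ ≤ Real.exp (-(3 * Real.log n)) := Real.exp_le_exp.2 (by linarith)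
    _ = _ := by
      rw [Real.exp_neg, show (3 : ℝ) * Real.log n = ((3 : ℕ) : ℝ) * Real.log n by norm_num,
        Real.exp_nat_mul, Real.exp_log hn']

theorem avg_exp_lower_tail_le {p N : ℝ} (h0 : 0 ≤ p) (h1 : p ≤ 1) (hn : 0 < n)
    (hlog : Real.log n ≤ N) (hN : 0 < N) (X : Finset (Fin n)) (hX : (X.card : ℝ) ≤ N) :
    avg p (fun S _ => Real.exp (√(Real.log n / N) *
      (p * X.card - 4 * √(N * Real.log n) - (S ∩ X).card))) ≤ ((n : ℝ) ^ 3)⁻¹ := by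
  set s := √(Real.log n / N) with hs
  set t := √(N * Real.log n)
  have hs1 : s ≤ 1 := Real.sqrt_le_one.2 (div_le_one_of_le₀ hlog hN.le)
  have hs0 : 0 ≤ s := Real.sqrt_nonneg _
  have h := avg_exp_inter_le h0 h1 (s := -s) (by rwa [abs_neg, abs_of_nonneg hs0]) X
  have e : ∀ S : Finset (Fin n), Real.exp (s * (p * X.card - 4 * t - (S ∩ X).card)) =
      Real.exp (s * (p * X.card - 4 * t)) * Real.exp (-s * (S ∩ X).card) := fun S => by
    rw [← Real.exp_add]; congr 1; ring
  simp_rw [e]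
  rw [avg_mul]
  refine le_trans (mul_le_mul_of_nonneg_left h (Real.exp_pos _).le) ?_
  rw [← Real.exp_add]
  refine le_trans (le_of_eq ?_) (exp_deviation_le hn hN hX)
  congr 1; ring

theorem avg_exp_upper_tail_le {p N : ℝ} (h0 : 0 ≤ p) (h1 : p ≤ 1) (hn : 0 < n)
    (hlog : Real.log n ≤ N) (hN : 0 < N) (X : Finset (Fin n)) (hX : (X.card : ℝ) ≤ N) :
    avg p (fun S _ => Real.exp (√(Real.log n / N) *
      ((S ∩ X).card - p * X.card - 4 * √(N * Real.log n)))) ≤ ((n : ℝ) ^ 3)⁻¹ := by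
  set s := √(Real.log n / N) with hs
  set t := √(N * Real.log n)
  have hs1 : s ≤ 1 := Real.sqrt_le_one.2 (div_le_one_of_le₀ hlog hN.le)
  have hs0 : 0 ≤ s := Real.sqrt_nonneg _
  have h := avg_exp_inter_le h0 h1 (s := s) (by rwa [abs_of_nonneg hs0]) X
  have e : ∀ S : Finset (Fin n), Real.exp (s * ((S ∩ X).card - p * X.card - 4 * t)) =
      Real.exp (s * (- p * X.card - 4 * t)) * Real.exp (s * (S ∩ X).card) := fun S => by
    rw [← Real.exp_add]; congr 1; ring
  simp_rw [e]
  rw [avg_mul]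
  refine le_trans (mul_le_mul_of_nonneg_left h (Real.exp_pos _).le) ?_
  rw [← Real.exp_add]
  refine le_trans (le_of_eq ?_) (exp_deviation_le hn hN hX)
  congr 1; ring

/-! ### Concentration of the arrivals in a window -/

/-- The number of stochastic customers in `T` whose realized period lies in `W`. -/
def landed (T W S : Finset (Fin n)) (σ : Equiv.Perm {i // i ∈ S}) : ℕ :=
  (univ.filter fun j : {i // i ∈ S} => (j : Fin n) ∈ T ∧ (σ j : Fin n) ∈ W).card

theorem card_subtype_filter (S X : Finset (Fin n)) :
    (univ.filter fun j : {i // i ∈ S} => (j : Fin n) ∈ X).card = (S ∩ X).card := by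
  rw [← filter_mem_eq_inter, ← card_map (Function.Embedding.subtype _)]
  congr 1
  ext i
  simp [and_comm]

theorem landed_add_landed_compl (T W S : Finset (Fin n)) (σ : Equiv.Perm {i // i ∈ S}) :
    landed T W S σ + landed T Wᶜ S σ = (S ∩ T).card := by
  rw [← card_subtype_filter, landed, landed, ← filter_filter, ← filter_filter]
  simp only [mem_compl]
  exact card_filter_add_card_filter_not _

theorem landed_le_card (v : Instance n) (P : Customer → Prop) [DecidablePred P]
    {T : Finset (Fin n)} (hT : ∀ j ∈ T, P (v j)) (W S : Finset (Fin n))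
    (σ : Equiv.Perm {i // i ∈ S}) :
    landed T W S σ ≤ (W.filter fun i => P (arrival v S σ i)).card := by
  refine card_le_card_of_injOn (fun j => (σ j : Fin n)) ?_ ?_
  · intro j hj
    simp only [coe_filter, mem_univ, true_and, Set.mem_ofPred_eq] at hj
    simp only [coe_filter, Set.mem_ofPred_eq]
    refine ⟨hj.2, ?_⟩
    have : (Equiv.Perm.ofSubtype σ).symm (σ j) = (j : Fin n) := by
      rw [Equiv.symm_apply_eq, Equiv.Perm.ofSubtype_apply_coe]
    rw [arrival, this]
    exact hT _ hj.1
  · intro i _ j _ h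
    exact σ.injective (Subtype.ext h)

/-- Given `S`, the number of customers of `T ∩ S` landing outside `W` is hypergeometric. -/
theorem avg_exp_landed_compl_le {p N : ℝ} (h0 : 0 ≤ p) (h1 : p ≤ 1) (hn : 0 < n)
    (hlog : Real.log n ≤ N) (hN : 0 < N) (T W : Finset (Fin n)) (hT : (T.card : ℝ) ≤ N) :
    avg p (fun S σ => Real.exp (√(Real.log n / N) * (landed T Wᶜ S σ -
      (S ∩ T).card * ((S ∩ Wᶜ).card / S.card) - 4 * √(N * Real.log n)))) ≤
      ((n : ℝ) ^ 3)⁻¹ := by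
  set s := √(Real.log n / N) with hs
  set t := √(N * Real.log n)
  have hs1 : s ≤ 1 := Real.sqrt_le_one.2 (div_le_one_of_le₀ hlog hN.le)
  have hs0 : 0 ≤ s := Real.sqrt_nonneg _
  have h1p : 0 ≤ 1 - p := by linarith
  rw [← avg_const (n := n) p ((n : ℝ) ^ 3)⁻¹, avg_of_forall]
  refine sum_le_sum fun S _ => mul_le_mul_of_nonneg_left ?_ (by positivity)
  set m : ℝ := ((S ∩ T).card : ℝ)
  set q : ℝ := ((S ∩ Wᶜ).card : ℝ) / S.card
  have h := sum_perm_exp_le (univ.filter fun j : {i // i ∈ S} => (j : Fin n) ∈ T)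
    (univ.filter fun j : {i // i ∈ S} => (j : Fin n) ∈ Wᶜ) hs0 hs1
  rw [card_subtype_filter, card_subtype_filter, Fintype.card_coe] at h
  have e : ∀ σ : Equiv.Perm {i // i ∈ S}, Real.exp (s * (landed T Wᶜ S σ - m * q - 4 * t)) =
      Real.exp (s * (- m * q - 4 * t)) * Real.exp (s * ((univ.filter fun j : {i // i ∈ S} =>
        (j : Fin n) ∈ T).filter fun j => σ j ∈
          univ.filter fun j : {i // i ∈ S} => (j : Fin n) ∈ Wᶜ).card) := fun σ => by
    rw [← Real.exp_add, filter_filter]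
    simp only [mem_filter, mem_univ, true_and, landed]
    congr 1; ring
  change (∑ σ : Equiv.Perm {i // i ∈ S}, Real.exp (s * (landed T Wᶜ S σ - m * q - 4 * t))) / _ ≤ _
  rw [sum_congr rfl fun σ _ => e σ, ← mul_sum, mul_div_assoc]
  refine le_trans (mul_le_mul_of_nonneg_left h (Real.exp_pos _).le) ?_
  rw [← Real.exp_add]
  have hm : m ≤ N := (Nat.cast_le.2 (card_le_card inter_subset_right)).trans hT
  refine le_trans (le_of_eq ?_) (exp_deviation_le hn hN hm)
  congr 1
  change s * (-m * q - 4 * t) + (m * q * s + m * s ^ 2) = _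
  ring

/-- The combination of the deviations of `|S|`, `|S ∩ W|`, `|S ∩ T|` and of the conditional
deviation into a lower bound for the number of customers of `T` that arrive in `W`. -/
theorem landed_ge_of_deviations {p : ℝ} {b : ℕ} (hp0 : 0 < p) (hp1 : p ≤ 1) (hn : 0 < n)
    (hbn : b ≤ n) (T W S : Finset (Fin n)) (σ : Equiv.Perm {i // i ∈ S}) (hT : T.card ≤ b)
    (d1 : p * T.card - 4 * √(b * Real.log n) ≤ (S ∩ T).card)
    (d2 : p * W.card - 4 * √(n * Real.log n) ≤ (S ∩ W).card)
    (d3 : (S.card : ℝ) ≤ p * n + 4 * √(n * Real.log n))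
    (d4 : (landed T Wᶜ S σ : ℝ) ≤
      (S ∩ T).card * ((S ∩ Wᶜ).card / S.card) + 4 * √(b * Real.log n)) :
    p * T.card * (W.card / n) - 16 * √(b * Real.log n) / p ≤ landed T W S σ := by
  have hn' : (0 : ℝ) < n := by exact_mod_cast hn
  have hL : 0 ≤ Real.log n := Real.log_natCast_nonneg n
  set R := √(b * Real.log n) with hR
  set t := 4 * √(n * Real.log n) with ht
  have hR0 : 0 ≤ R := Real.sqrt_nonneg _
  have hRp : R ≤ R / p := by rw [le_div_iff₀ hp0]; nlinarith
  have ht0 : 0 ≤ t := by positivity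
  set w : ℝ := W.card / n with hw
  have hw0 : 0 ≤ w := by positivity
  have hw1 : w ≤ 1 := div_le_one_of_le₀
    (by exact_mod_cast (card_le_univ W).trans_eq (Fintype.card_fin n)) hn'.le
  have hWw : (W.card : ℝ) = w * n := by rw [hw]; field_simp
  have hsum : (landed T W S σ : ℝ) + landed T Wᶜ S σ = (S ∩ T).card := by
    exact_mod_cast landed_add_landed_compl T W S σ
  have hSW : ((S ∩ W).card : ℝ) + (S ∩ Wᶜ).card = S.card := by
    rw [← card_inter_add_card_sdiff S W]; rw [← sdiff_eq_inter_compl]; push_cast; rfl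
  have hm0 : (0 : ℝ) ≤ (S ∩ T).card := Nat.cast_nonneg _
  have hmb : ((S ∩ T).card : ℝ) ≤ b := by exact_mod_cast (card_le_card inter_subset_right).trans hT
  have e16 : 16 * R / p = 16 * (R / p) := by ring
  rw [e16]
  -- the quotients by `|S|` have their junk value for `S = ∅`, where `d1` makes the bound trivial
  rcases (Nat.eq_zero_or_pos S.card) with hk | hk
  · have : (S ∩ T).card = 0 := by
      rw [card_eq_zero.1 hk, empty_inter, card_empty]
    rw [this] at d1
    push_cast at d1
    have : p * T.card * w ≤ 4 * R := by
      have : (0 : ℝ) ≤ p * T.card := mul_nonneg hp0.le (Nat.cast_nonneg _)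
      nlinarith
    have : (0 : ℝ) ≤ landed T W S σ := Nat.cast_nonneg _
    linarith
  have hk' : (0 : ℝ) < S.card := by exact_mod_cast hk
  set m : ℝ := ((S ∩ T).card : ℝ)
  have hfrac : w - 2 * t / (p * n) ≤ (S ∩ W).card / S.card := by
    rw [le_div_iff₀ hk']
    rcases le_or_gt (w - 2 * t / (p * n)) 0 with hneg | hpos
    · have : (0 : ℝ) ≤ (S ∩ W).card := Nat.cast_nonneg _
      nlinarith
    · refine le_trans (mul_le_mul_of_nonneg_left d3 hpos.le) (le_trans ?_ d2)
      rw [hWw]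
      have e : (w - 2 * t / (p * n)) * (p * n + t) =
          p * (w * n) + w * t - 2 * t - 2 * t / (p * n) * t := by
        have h0 : 2 * t / (p * n) * (p * n) = 2 * t := div_mul_cancel₀ _ (by positivity)
        linear_combination -h0
      rw [e]
      have : 0 ≤ 2 * t / (p * n) * t := by positivity
      nlinarith
  have hq : ((S ∩ Wᶜ).card : ℝ) / S.card = 1 - (S ∩ W).card / S.card := by
    rw [eq_sub_iff_add_eq, ← add_div, add_comm, hSW, div_self hk'.ne']
  rw [hq] at d4
  -- as `b ≤ n`, the deviation `√(n log n) / n` of the fraction `|S ∩ W| / |S|` costs only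
  -- `√(b log n)` when it is multiplied by `b`
  have hbt : b * (2 * t / (p * n)) ≤ 8 * (R / p) := by
    have h1 : b * √(n * Real.log n) ≤ n * R := by
      rw [hR, Real.sqrt_mul hn'.le, Real.sqrt_mul (by positivity)]
      have hb : (b : ℝ) = √b * √b := (Real.mul_self_sqrt (by positivity)).symm
      have hnn : (n : ℝ) = √n * √n := (Real.mul_self_sqrt (by positivity)).symm
      have hsq : √(b : ℝ) ≤ √(n : ℝ) := Real.sqrt_le_sqrt (by exact_mod_cast hbn)
      calc (b : ℝ) * (√n * √(Real.log n)) = √b * (√b * √n * √(Real.log n)) := by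
            conv_lhs => rw [hb]
            ring
        _ ≤ √n * (√b * √n * √(Real.log n)) := by gcongr
        _ = (√n * √n) * (√b * √(Real.log n)) := by ring
        _ = _ := by rw [← hnn]
    rw [ht]
    rw [show (b : ℝ) * (2 * (4 * √(n * Real.log n)) / (p * n)) =
      8 * (b * √(n * Real.log n)) / (p * n) by ring, div_le_iff₀ (by positivity)]
    rw [show 8 * (R / p) * (p * n) = 8 * (n * R) by field_simp]
    linarith
  have hmt : m * (2 * t / (p * n)) ≤ 8 * (R / p) :=
    le_trans (mul_le_mul_of_nonneg_right hmb (by positivity)) hbt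
  have hmf := mul_le_mul_of_nonneg_left hfrac hm0
  have hmw := mul_le_mul_of_nonneg_right d1 hw0
  have hRw : R * w ≤ R := by nlinarith
  nlinarith

/-- An exponential penalty that bounds the indicator of the event that markedly fewer than
`p |T| |W| / n` customers of `T` arrive in `W`. -/
noncomputable def penalty (p : ℝ) (b : ℕ) (T W S : Finset (Fin n))
    (σ : Equiv.Perm {i // i ∈ S}) : ℝ :=
  Real.exp (√(Real.log n / b) * (p * T.card - 4 * √(b * Real.log n) - (S ∩ T).card)) +
  Real.exp (√(Real.log n / n) * (p * W.card - 4 * √(n * Real.log n) - (S ∩ W).card)) +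
  Real.exp (√(Real.log n / n) * ((S ∩ univ).card - p * (univ : Finset (Fin n)).card -
    4 * √(n * Real.log n))) +
  Real.exp (√(Real.log n / b) * (landed T Wᶜ S σ -
    (S ∩ T).card * ((S ∩ Wᶜ).card / S.card) - 4 * √(b * Real.log n)))

theorem penalty_nonneg (p : ℝ) (b : ℕ) (T W S : Finset (Fin n)) (σ : Equiv.Perm {i // i ∈ S}) :
    0 ≤ penalty p b T W S σ := by unfold penalty; positivity

theorem avg_penalty_le {p : ℝ} {b : ℕ} (hp0 : 0 ≤ p) (hp1 : p ≤ 1) (hb : 0 < b)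
    (hbn : b ≤ n) (hlog : Real.log n ≤ b) (T W : Finset (Fin n)) (hT : T.card ≤ b) :
    avg p (penalty p b T W) ≤ 4 * ((n : ℝ) ^ 3)⁻¹ := by
  have hn : 0 < n := hb.trans_le hbn
  have hn' : (0 : ℝ) < n := by exact_mod_cast hn
  have hb' : (0 : ℝ) < b := by exact_mod_cast hb
  have hlog' : Real.log n ≤ n := hlog.trans (by exact_mod_cast hbn)
  have h1 := avg_exp_lower_tail_le hp0 hp1 hn hlog hb' T (by exact_mod_cast hT)
  have h2 := avg_exp_lower_tail_le hp0 hp1 hn hlog' hn' W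
    (by exact_mod_cast (card_le_univ W).trans_eq (Fintype.card_fin n))
  have h3 := avg_exp_upper_tail_le hp0 hp1 hn hlog' hn' (univ : Finset (Fin n)) (by simp)
  have h4 := avg_exp_landed_compl_le hp0 hp1 hn hlog hb' T W (by exact_mod_cast hT)
  change avg p (fun S σ => penalty p b T W S σ) ≤ _
  simp only [penalty]
  rw [avg_add, avg_add, avg_add]
  linarith

theorem landed_ge_of_penalty_lt_one {p : ℝ} {b : ℕ} (hp0 : 0 < p) (hp1 : p ≤ 1) (hb : 0 < b)
    (hbn : b ≤ n) (T W S : Finset (Fin n)) (σ : Equiv.Perm {i // i ∈ S}) (hT : T.card ≤ b)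
    (h : penalty p b T W S σ < 1) :
    p * T.card * (W.card / n) - 16 * √(b * Real.log n) / p ≤ landed T W S σ := by
  have aux : ∀ {s x : ℝ}, 0 ≤ s → Real.exp (s * x) < 1 → x ≤ 0 := fun {s x} hs hx => by
    by_contra! hpos
    exact absurd hx (not_lt.2 (Real.one_le_exp (mul_nonneg hs hpos.le)))
  unfold penalty at h
  have p1 := Real.exp_pos (√(Real.log n / b) *
    (p * T.card - 4 * √(b * Real.log n) - (S ∩ T).card))
  have p2 := Real.exp_pos (√(Real.log n / n) *
    (p * W.card - 4 * √(n * Real.log n) - (S ∩ W).card))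
  have p3 := Real.exp_pos (√(Real.log n / n) * ((S ∩ univ).card -
    p * (univ : Finset (Fin n)).card - 4 * √(n * Real.log n)))
  have p4 := Real.exp_pos (√(Real.log n / b) * (landed T Wᶜ S σ -
    (S ∩ T).card * ((S ∩ Wᶜ).card / S.card) - 4 * √(b * Real.log n)))
  have d1 := aux (Real.sqrt_nonneg _) (lt_of_le_of_lt (by linarith) h :
    Real.exp (√(Real.log n / b) * (p * T.card - 4 * √(b * Real.log n) - (S ∩ T).card)) < 1)
  have d2 := aux (Real.sqrt_nonneg _) (lt_of_le_of_lt (by linarith) h :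
    Real.exp (√(Real.log n / n) * (p * W.card - 4 * √(n * Real.log n) - (S ∩ W).card)) < 1)
  have d3 := aux (Real.sqrt_nonneg _) (lt_of_le_of_lt (by linarith) h :
    Real.exp (√(Real.log n / n) * ((S ∩ univ).card -
      p * (univ : Finset (Fin n)).card - 4 * √(n * Real.log n))) < 1)
  have d4 := aux (Real.sqrt_nonneg _) (lt_of_le_of_lt (by linarith) h :
    Real.exp (√(Real.log n / b) * (landed T Wᶜ S σ -
      (S ∩ T).card * ((S ∩ Wᶜ).card / S.card) - 4 * √(b * Real.log n))) < 1)
  rw [inter_univ, card_univ, Fintype.card_fin] at d3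
  exact landed_ge_of_deviations hp0 hp1 (hb.trans_le hbn) hbn T W S σ hT (by linarith)
    (by linarith) (by linarith) (by linarith)

/-! ### The run of the algorithm on one realized sequence -/

section Run

variable (b : ℕ) (a p : ℝ) (v : Instance n)

/-- The number of arrivals satisfying `P` in the periods `s + 1, …, t`. -/
def arrivals (P : Customer → Prop) [DecidablePred P] (s t : ℕ) : ℕ :=
  (univ.filter fun i : Fin n => (s ≤ i ∧ (i : ℕ) < t) ∧ P (v i)).card

theorem arrivals_self (P : Customer → Prop) [DecidablePred P] (t : ℕ) :
    arrivals v P t t = 0 := by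
  rw [arrivals, card_eq_zero, filter_eq_empty_iff]
  intro i _; omega

theorem arrivals_succ (P : Customer → Prop) [DecidablePred P] {s t : ℕ} (hst : s ≤ t)
    (ht : t < n) :
    arrivals v P s (t + 1) = arrivals v P s t + if P (v ⟨t, ht⟩) then 1 else 0 := by
  have e : (univ.filter fun i : Fin n => (s ≤ i ∧ (i : ℕ) < t + 1) ∧ P (v i)) =
      (univ.filter fun i : Fin n => (s ≤ i ∧ (i : ℕ) < t) ∧ P (v i)) ∪
        if P (v ⟨t, ht⟩) then {⟨t, ht⟩} else ∅ := by
    ext i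
    simp only [mem_filter, mem_univ, true_and, mem_union]
    rcases eq_or_ne i ⟨t, ht⟩ with rfl | hi
    · by_cases hP : P (v ⟨t, ht⟩) <;> simp [hP, hst]
    · have : (i : ℕ) ≠ t := fun h => hi (Fin.ext h)
      have h2 : ¬ i ∈ (if P (v ⟨t, ht⟩) then ({⟨t, ht⟩} : Finset (Fin n)) else ∅) := by
        split_ifs <;> simp [hi]
      simp only [h2, or_false, and_congr_left_iff]
      intro _; omega
  rw [arrivals, e, card_union_of_disjoint, arrivals]
  · split_ifs <;> simp
  · split_ifs
    · rw [disjoint_singleton_right]; simp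
    · exact disjoint_empty_right _

theorem arrivals_zero (P : Customer → Prop) [DecidablePred P] :
    arrivals v P 0 n = (univ.filter fun i => P (v i)).card := by
  simp [arrivals]

theorem counters_succ {t : ℕ} (ht : t < n) :
    counters b a p v (t + 1) = step n b a p (t + 1) (v ⟨t, ht⟩) (counters b a p v t) := by
  rw [counters, dif_pos ht]

/-- The number of units sold. -/
def Counters.total (q : Counters) : ℕ := q.q₁ + q.q₂e + q.q₂f

/-- The assertions that are preserved by every step: what the counters say about the arrivals up to
period `t`. The period `s` in the field `evolving` is the last one in which the evolving threshold
rule was applied (`0` if it never was); in the field `rejected` it is the last one in which a type-2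
customer was turned away although there was inventory. -/
structure RunInvariant (t : ℕ) (q : Counters) : Prop where
  total_le : q.total ≤ b
  fixed_le : q.q₂f ≤ ⌊(1 - p) / (2 - a) * b⌋₊
  type1 : q.total < b → q.q₁ = arrivals v (· = .type1) 0 t
  evolving : ∃ s ≤ t, (q.q₂e + arrivals v (· = .type1) 0 s : ℝ) ≤ s / n * p * b
  rejected : q.total < b → q.q₂e + q.q₂f = arrivals v (· = .type2) 0 t ∨
    (q.q₂f = ⌊(1 - p) / (2 - a) * b⌋₊ ∧ ∃ s ≤ t,
      ⌊(s : ℝ) / n * p * b⌋₊ + arrivals v (· ≠ .none) s t ≤ q.q₁ + q.q₂e)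
  type1_le : q.q₁ ≤ arrivals v (· = .type1) 0 t
  type2_le : q.q₂e + q.q₂f ≤ arrivals v (· = .type2) 0 t

theorem runInvariant {t : ℕ} (ht : t ≤ n) : RunInvariant b a p v t (counters b a p v t) := by
  induction t with
  | zero =>
    refine ⟨by simp [counters, Counters.total], by simp [counters], fun _ => ?_, ⟨0, le_rfl, ?_⟩,
      fun _ => Or.inl ?_, by simp [counters], by simp [counters]⟩
    · rw [arrivals_self]; rfl
    · rw [arrivals_self]; simp [counters]
    · rw [arrivals_self]; rfl
  | succ t ih =>
    have htn : t < n := ht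
    obtain ⟨i1, i2, i3, ⟨s, hs, i4⟩, i5, i6, i7⟩ := ih htn.le
    rw [counters_succ b a p v htn]
    have a1 := arrivals_succ v (· = .type1) (Nat.zero_le t) htn
    have a2 := arrivals_succ v (· = .type2) (Nat.zero_le t) htn
    have a3 := fun r (hr : r ≤ t) => arrivals_succ v (· ≠ .none) hr htn
    generalize counters b a p v t = q at *
    unfold Counters.total at *
    unfold step
    by_cases hb : q.q₁ + q.q₂e + q.q₂f < b
    · rw [if_pos hb]
      have j3 := i3 hb
      have j5 := i5 hb
      generalize v ⟨t, htn⟩ = c at *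
      cases c with
      | none =>
        simp only [reduceCtorEq, if_false, add_zero] at a1 a2
        replace a3 := fun r hr => (a3 r hr).trans (by rw [if_neg (by decide), add_zero])
        dsimp only
        refine ⟨i1, i2, fun _ => j3.trans a1.symm, ⟨s, by omega, i4⟩, fun _ => ?_, by omega, by omega⟩
        rcases j5 with h | ⟨h, r, hr, h'⟩
        · exact Or.inl (h.trans a2.symm)
        · exact Or.inr ⟨h, r, by omega, by rw [a3 r hr]; exact h'⟩
      | type1 =>
        simp only [reduceCtorEq, if_false, add_zero, if_true] at a1 a2
        replace a3 := fun r hr => (a3 r hr).trans (by rw [if_pos (by decide)])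
        dsimp only
        refine ⟨by simp only [Counters.total]; omega, i2, fun _ => by dsimp only; omega,
          ⟨s, by omega, i4⟩, fun _ => ?_, by dsimp only; omega, by dsimp only; omega⟩
        rcases j5 with h | ⟨h, r, hr, h'⟩
        · exact Or.inl (h.trans a2.symm)
        · exact Or.inr ⟨h, r, by omega, by rw [a3 r hr]; dsimp only; omega⟩
      | type2 =>
        simp only [reduceCtorEq, if_false, add_zero, if_true] at a1 a2
        replace a3 := fun r hr => (a3 r hr).trans (by rw [if_pos (by decide)])
        dsimp only
        split_ifs with he hf
        · refine ⟨by simp only [Counters.total]; omega, i2, fun _ => by dsimp only; omega,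
            ⟨t + 1, le_rfl, ?_⟩, fun _ => ?_, by dsimp only; omega, by dsimp only; omega⟩
          · have h1 : q.q₂e + 1 + arrivals v (· = .type1) 0 (t + 1) ≤
                ⌊((t + 1 : ℕ) : ℝ) / n * p * b⌋₊ := by omega
            have hpos : 0 < ⌊((t + 1 : ℕ) : ℝ) / n * p * b⌋₊ := by omega
            have h2 := Nat.floor_le (Nat.pos_of_floor_pos hpos).le
            have h3 : ((q.q₂e + 1 + arrivals v (· = .type1) 0 (t + 1) : ℕ) : ℝ) ≤
                ⌊((t + 1 : ℕ) : ℝ) / n * p * b⌋₊ := by exact_mod_cast h1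
            push_cast at h2 h3 ⊢
            linarith
          · rcases j5 with h | ⟨h, r, hr, h'⟩
            · exact Or.inl (by dsimp only; omega)
            · exact Or.inr ⟨h, r, by omega, by rw [a3 r hr]; dsimp only; omega⟩
        · refine ⟨by simp only [Counters.total]; omega, by dsimp only; omega,
            fun _ => by dsimp only; omega, ⟨s, by omega, i4⟩, fun _ => ?_, by dsimp only; omega,
            by dsimp only; omega⟩
          rcases j5 with h | ⟨h, r, hr, h'⟩
          · exact Or.inl (by dsimp only; omega)
          · omega
        · refine ⟨i1, i2, fun _ => j3.trans a1.symm, ⟨s, by omega, i4⟩,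
            fun _ => Or.inr ⟨by omega, t + 1, le_rfl, ?_⟩, by omega, by omega⟩
          rw [arrivals_self]; omega
    · rw [if_neg hb]
      exact ⟨i1, i2, fun h => absurd h hb, ⟨s, by omega, i4⟩, fun h => absurd h hb,
        by omega, by omega⟩

end Run

/-! ### The revenue of the algorithm against the offline optimum -/

theorem card_filter_arrival (v : Instance n) (S : Finset (Fin n)) (σ : Equiv.Perm {i // i ∈ S})
    (P : Customer → Prop) [DecidablePred P] :
    (univ.filter fun i => P (arrival v S σ i)).card = (univ.filter fun i => P (v i)).card :=
  card_equiv (Equiv.Perm.ofSubtype σ).symm fun i => by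
    simp only [mem_filter, mem_univ, true_and]; rfl

theorem opt_arrival (b : ℕ) {a : ℝ} (h0 : 0 < a) (h1 : a < 1) (v : Instance n)
    (S : Finset (Fin n)) (σ : Equiv.Perm {i // i ∈ S}) :
    opt b a (arrival v S σ) = opt b a v := by
  have e1 : numType1 (arrival v S σ) = numType1 v := card_filter_arrival v S σ (· = .type1)
  have e2 : numType2 (arrival v S σ) = numType2 v := card_filter_arrival v S σ (· = .type2)
  rw [opt_eq b a h0 h1, opt_eq b a h0 h1, e1, e2]

theorem card_filter_ne_none (v : Instance n) :
    (univ.filter fun i => v i ≠ .none).card = numType1 v + numType2 v := by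
  rw [numType1, numType2, ← card_union_of_disjoint]
  · congr 1
    ext i
    cases h : v i <;> simp [h]
  · rw [disjoint_filter]; intro i _ h; simp [h]

theorem fixedThreshold_bounds {a p : ℝ} (h0 : 0 < a) (h1 : a < 1) (hp1 : p < 1) :
    (1 - p) / 2 ≤ (1 - p) / (2 - a) ∧ (2 - a) * ((1 - p) / (2 - a)) = 1 - p ∧
      p + (1 - p) / (2 - a) ≤ 1 := by
  have h2 : 0 < 2 - a := by linarith
  refine ⟨div_le_div_of_nonneg_left (by linarith) h2 (by linarith), mul_div_cancel₀ _ h2.ne', ?_⟩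
  have : (1 - p) / (2 - a) ≤ 1 - p := div_le_self (by linarith) (by linarith)
  linarith

/-- If some unit remains unsold, every type-1 customer has been accepted, and either every type-2
customer too, or the fixed threshold has been reached. In the latter case the units sold outside
the fixed threshold are, up to the deviation, at least `p` times those that the optimum sells. -/
theorem revenue_of_unsold {b : ℕ} {a p D : ℝ} (h0 : 0 < a) (h1 : a < 1) (hp0 : 0 < p)
    (hp1 : p < 1) (hn : 0 < n) (hD : 0 ≤ D) (V : Instance n)
    (h : ∀ s ≤ n, p * (min b (numType1 V + numType2 V) : ℕ) * ((n - s : ℕ) / n) - D ≤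
      arrivals V (· ≠ .none) s n)
    (hb : (counters b a p V n).total < b) :
    (p + (1 - p) / (2 - a)) * opt b a V ≤ alg b a p V ∨
      (a * ((1 - p) / (2 - a) * b - 1) ≤ opt b a V ∧
        (p + (1 - p) / (2 - a)) * opt b a V - (D + 2) ≤ alg b a p V) := by
  obtain ⟨i1, i2, i3, -, i5, -, i6⟩ := runInvariant b a p V le_rfl
  obtain ⟨-, -, hc⟩ := fixedThreshold_bounds h0 h1 hp1
  have hθ0 : 0 ≤ (1 - p) / (2 - a) := div_nonneg (by linarith) (by linarith)
  have j3 := i3 hb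
  have j5 := i5 hb
  rw [arrivals_zero] at i6 j3 j5
  change _ = numType1 V at j3
  change _ ≤ numType2 V at i6
  change _ = numType2 V ∨ _ at j5
  rw [opt_eq b a h0 h1, alg]
  unfold Counters.total at *
  generalize counters b a p V n = q at *
  generalize (1 - p) / (2 - a) = θ at *
  set m₁ := numType1 V
  set m₂ := numType2 V
  rw [min_eq_right (by omega : m₁ ≤ b), j3]
  have hopt0 : (0 : ℝ) ≤ m₁ + a * (min m₂ (b - m₁) : ℕ) := by positivity
  rcases j5 with j5 | ⟨j5, s, hs, j6⟩
  · left
    have e : (min m₂ (b - m₁) : ℕ) ≤ (q.q₂e : ℝ) + q.q₂f := by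
      exact_mod_cast (min_le_left _ _).trans j5.ge
    have := mul_le_mul_of_nonneg_left e h0.le
    nlinarith
  · right
    have hfl : θ * b - 1 ≤ q.q₂f := by rw [j5]; exact (Nat.sub_one_lt_floor _).le
    have hfl' : (s : ℝ) / n * p * b - 1 ≤ ⌊(s : ℝ) / n * p * b⌋₊ := (Nat.sub_one_lt_floor _).le
    constructor
    · have e : (q.q₂f : ℝ) ≤ (min m₂ (b - m₁) : ℕ) := by exact_mod_cast (by omega)
      have : (0 : ℝ) ≤ m₁ := Nat.cast_nonneg _
      nlinarith
    · have j7 : (⌊(s : ℝ) / n * p * b⌋₊ : ℝ) + arrivals V (· ≠ .none) s n ≤ m₁ + q.q₂e := by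
        exact_mod_cast j3 ▸ j6
      have h7 := h s hs
      have hM : ((min b (m₁ + m₂) : ℕ) : ℝ) = m₁ + (min m₂ (b - m₁) : ℕ) := by
        exact_mod_cast (by omega)
      have hMb : ((min b (m₁ + m₂) : ℕ) : ℝ) ≤ b := by exact_mod_cast min_le_left _ _
      set M : ℝ := ((min b (m₁ + m₂) : ℕ) : ℝ)
      have hsplit : (m₁ : ℝ) + a * (min m₂ (b - m₁) : ℕ) = (1 - a) * m₁ + a * M := by
        rw [hM]; ring
      rw [hsplit]
      have hs' : ((n - s : ℕ) : ℝ) / n = 1 - s / n := by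
        rw [Nat.cast_sub hs, sub_div, div_self (by positivity)]
      rw [hs'] at h7
      have hsn : (0 : ℝ) ≤ s / n := by positivity
      have hsum : p * M - D - 1 ≤ m₁ + q.q₂e := by
        have : s / n * p * M ≤ s / n * p * b := mul_le_mul_of_nonneg_left hMb (by positivity)
        linarith
      have g1 := mul_le_mul_of_nonneg_left hsum h0.le
      have g2 := mul_le_mul_of_nonneg_left hfl h0.le
      have g3 : 0 ≤ (1 - (p + θ)) * ((1 - a) * m₁) :=
        mul_nonneg (by linarith) (mul_nonneg (by linarith) (Nat.cast_nonneg _))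
      have g4 : 0 ≤ a * θ * (b - M) := mul_nonneg (mul_nonneg h0.le hθ0) (by linarith)
      have g5 : a * (D + 2) ≤ D + 2 := by nlinarith
      linarith

/-- If all units are sold, the loss is caused by the type-2 customers that are accepted, and their
number is at most `p (b - m₁)⁺ + θ b` up to the deviation, `m₁` being the number of type-1
customers. -/
theorem revenue_of_sold_out {b : ℕ} {a p D : ℝ} (h0 : 0 < a) (h1 : a < 1) (hp0 : 0 < p)
    (hp1 : p < 1) (hn : 0 < n) (hD : 0 ≤ D) (V : Instance n)
    (h : ∀ s ≤ n, p * (min b (numType1 V) : ℕ) * ((s : ℝ) / n) - D ≤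
      arrivals V (· = .type1) 0 s)
    (hb : (counters b a p V n).total = b) :
    a * ((1 - p) / (2 - a) * b - 1) ≤ opt b a V ∧
      (p + (1 - p) / (2 - a)) * opt b a V - (D + 2) ≤ alg b a p V := by
  obtain ⟨-, i2, -, ⟨s, hs, i4⟩, -, i6, i7⟩ := runInvariant b a p V le_rfl
  obtain ⟨-, he, hc⟩ := fixedThreshold_bounds h0 h1 hp1
  have hθ0 : 0 ≤ (1 - p) / (2 - a) := div_nonneg (by linarith) (by linarith)
  rw [arrivals_zero] at i6 i7
  change _ ≤ numType1 V at i6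
  change _ ≤ numType2 V at i7
  have h7 := h s hs
  rw [opt_eq b a h0 h1, alg]
  unfold Counters.total at *
  generalize counters b a p V n = q at *
  have hfl : (q.q₂f : ℝ) ≤ (1 - p) / (2 - a) * b :=
    (Nat.cast_le.2 i2).trans (Nat.floor_le (mul_nonneg hθ0 (Nat.cast_nonneg _)))
  generalize (1 - p) / (2 - a) = θ at *
  set m₁ := numType1 V
  set m₂ := numType2 V
  have hM : ((min m₂ (b - m₁) : ℕ) : ℝ) = b - (min b m₁ : ℕ) := by
    rw [eq_sub_iff_add_eq]; exact_mod_cast (by omega)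
  have hmb : ((min b m₁ : ℕ) : ℝ) ≤ b := by exact_mod_cast min_le_left _ _
  rw [hM]
  have hm0 : (0 : ℝ) ≤ (min b m₁ : ℕ) := Nat.cast_nonneg _
  have hb' : (q.q₁ : ℝ) + q.q₂e + q.q₂f = b := by exact_mod_cast hb
  set m : ℝ := ((min b m₁ : ℕ) : ℝ)
  have hb0 : (0 : ℝ) ≤ b := Nat.cast_nonneg _
  constructor
  · have g1 : 0 ≤ (1 - a) * m := mul_nonneg (by linarith) hm0
    have g2 : 0 ≤ a * ((1 - θ) * b) := mul_nonneg h0.le (mul_nonneg (by linarith) hb0)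
    linarith
  · have hsn : (s : ℝ) / n ≤ 1 := div_le_one_of_le₀ (by exact_mod_cast hs) (by positivity)
    have hsn0 : (0 : ℝ) ≤ s / n := by positivity
    have g1 : (q.q₂e : ℝ) ≤ p * (b - m) + D := by
      have : 0 ≤ (1 - s / n) * (p * (b - m)) :=
        mul_nonneg (by linarith) (mul_nonneg hp0.le (by linarith))
      linarith
    have g2 : (1 - a) * (q.q₂e + q.q₂f) ≤ (1 - a) * (p * (b - m) + D + θ * b) :=
      mul_le_mul_of_nonneg_left (by linarith) (by linarith)
    have g3 : (q.q₁ : ℝ) + a * (q.q₂e + q.q₂f) = b - (1 - a) * (q.q₂e + q.q₂f) := by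
      rw [← hb']; ring
    have g4 : (1 - a) * D ≤ D := by nlinarith
    -- the remaining inequality is affine in `m` and is an equality at `m = b`
    have g6 : (b - (1 - a) * (p * (b - m) + θ * b)) - (p + θ) * (m + a * (b - m)) =
        (1 - p - (2 - a) * θ) * b + (1 - a) * θ * (b - m) := by ring
    have g7 : 0 ≤ (1 - a) * θ * (b - m) :=
      mul_nonneg (mul_nonneg (by linarith) hθ0) (by linarith)
    rw [he, sub_self, zero_mul, zero_add] at g6
    linarith

/-! ### The union bound and the competitive ratio -/

/-- The periods `1, …, s`. -/
def initialPeriods (n s : ℕ) : Finset (Fin n) := univ.filter fun i => (i : ℕ) < s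

/-- The periods `s + 1, …, n`. -/
def finalPeriods (n s : ℕ) : Finset (Fin n) := univ.filter fun i => s ≤ (i : ℕ)

theorem card_initialPeriods {s : ℕ} (hs : s ≤ n) : (initialPeriods n s).card = s := by
  rw [initialPeriods, Fin.card_filter_val_lt, min_eq_right hs]

theorem card_finalPeriods {s : ℕ} (hs : s ≤ n) : (finalPeriods n s).card = n - s := by
  have h := card_filter_add_card_filter_not (s := (univ : Finset (Fin n))) fun i => (i : ℕ) < s
  simp only [not_lt, card_univ, Fintype.card_fin] at h
  have h' := card_initialPeriods hs
  rw [initialPeriods] at h'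
  rw [finalPeriods]
  omega

theorem opt_nonneg (b : ℕ) {a : ℝ} (h0 : 0 < a) (h1 : a < 1) (v : Instance n) :
    0 ≤ opt b a v := by
  rw [opt_eq b a h0 h1]; positivity

theorem alg_nonneg (b : ℕ) {a : ℝ} (h0 : 0 < a) (p : ℝ) (v : Instance n) : 0 ≤ alg b a p v := by
  unfold alg; positivity

/-- On the event that all penalties are small the algorithm loses at most `18 √(b log n) / p`
against the claimed ratio, and it loses anything only if the optimum has the order of `a b`. -/
theorem revenue_of_penalty_lt_one {b : ℕ} {a p : ℝ} (h0 : 0 < a) (h1 : a < 1) (hp0 : 0 < p)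
    (hp1 : p < 1) (hb : 0 < b) (hbn : b ≤ n) (v : Instance n) {T₁ T₂ : Finset (Fin n)}
    (hT₁ : ∀ j ∈ T₁, v j = .type1) (hT₁c : T₁.card = min b (numType1 v))
    (hT₂ : ∀ j ∈ T₂, v j ≠ .none) (hT₂c : T₂.card = min b (numType1 v + numType2 v))
    (S : Finset (Fin n)) (σ : Equiv.Perm {i // i ∈ S})
    (h : ∀ s ≤ n, penalty p b T₁ (initialPeriods n s) S σ < 1 ∧
      penalty p b T₂ (finalPeriods n s) S σ < 1) :
    (p + (1 - p) / (2 - a)) * opt b a v ≤ alg b a p (arrival v S σ) ∨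
      (a * ((1 - p) / (2 - a) * b - 1) ≤ opt b a v ∧
        (p + (1 - p) / (2 - a)) * opt b a v - (16 * √(b * Real.log n) / p + 2) ≤
          alg b a p (arrival v S σ)) := by
  have hn : 0 < n := hb.trans_le hbn
  have hD : 0 ≤ 16 * √(b * Real.log n) / p := by positivity
  have e1 : numType1 (arrival v S σ) = numType1 v := card_filter_arrival v S σ (· = .type1)
  have e2 : numType2 (arrival v S σ) = numType2 v := card_filter_arrival v S σ (· = .type2)
  rw [← opt_arrival b h0 h1 v S σ]
  rcases ((runInvariant b a p (arrival v S σ) le_rfl).total_le).lt_or_eq with hlt | heq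
  · refine revenue_of_unsold h0 h1 hp0 hp1 hn hD _ (fun s hs => ?_) hlt
    have g := landed_ge_of_penalty_lt_one hp0 hp1.le hb hbn T₂ (finalPeriods n s) S σ
      (hT₂c.trans_le (min_le_left _ _)) (h s hs).2
    rw [e1, e2, ← hT₂c]
    rw [card_finalPeriods hs] at g
    refine g.trans (Nat.cast_le.2 ((landed_le_card v (· ≠ .none) hT₂ _ S σ).trans ?_))
    rw [arrivals, finalPeriods, filter_filter]
    simp
  · right
    refine revenue_of_sold_out h0 h1 hp0 hp1 hn hD _ (fun s hs => ?_) heq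
    have g := landed_ge_of_penalty_lt_one hp0 hp1.le hb hbn T₁ (initialPeriods n s) S σ
      (hT₁c.trans_le (min_le_left _ _)) (h s hs).1
    rw [e1, ← hT₁c]
    rw [card_initialPeriods hs] at g
    refine g.trans (Nat.cast_le.2 ((landed_le_card v (· = .type1) hT₁ _ S σ).trans ?_))
    rw [arrivals, initialPeriods, filter_filter]
    simp

theorem one_le_log {n : ℕ} (hn : 3 ≤ n) : 1 ≤ Real.log n := by
  have h3 : (3 : ℝ) ≤ n := by exact_mod_cast hn
  rw [Real.le_log_iff_exp_le (by linarith)]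
  linarith [Real.exp_one_lt_d9]

/-- The error term of the ratio, applied to an optimum of the order of `a b`, covers the additive
loss. -/
theorem additive_loss_le {b : ℕ} {a p r L x : ℝ} (h0 : 0 < a) (h1 : a < 1) (hp0 : 0 < p)
    (hp1 : p < 1) (hb : 0 < b) (hL : 1 ≤ L) (hr : 0 < r) (hrb : b * r ^ 2 = L)
    (hsmall : 200 * (1 / (a * (1 - p) * p) * r) < 1)
    (hx : a * ((1 - p) / (2 - a) * b - 1) ≤ x) :
    16 * √(b * L) / p + 2 ≤ 100 * (1 / (a * (1 - p) * p) * r) * x := by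
  have hb0 : (0 : ℝ) < b := by exact_mod_cast hb
  have hp : 0 < 1 - p := by linarith
  have hR : √(b * L) = b * r := by
    rw [← hrb, show (b : ℝ) * (b * r ^ 2) = (b * r) ^ 2 by ring, Real.sqrt_sq (by positivity)]
  rw [hR]
  have hd : 0 < a * (1 - p) * p := by positivity
  have hr1 : 200 * r < 1 - p := by
    have h : 200 * r < a * (1 - p) * p := by
      rw [show 200 * (1 / (a * (1 - p) * p) * r) = 200 * r / (a * (1 - p) * p) by ring,
        div_lt_one hd] at hsmall
      exact hsmall
    have : a * (1 - p) * p ≤ 1 * (1 - p) * 1 := by gcongr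
    linarith
  have hR1 : 1 ≤ b * r := by nlinarith
  have hb4 : 4 ≤ (1 - p) * b := by nlinarith
  have hx' : a * ((1 - p) * b / 4) ≤ x := by
    refine le_trans (mul_le_mul_of_nonneg_left ?_ h0.le) hx
    have := mul_le_mul_of_nonneg_right (fixedThreshold_bounds h0 h1 hp1).1 hb0.le
    linarith
  have e : 100 * (1 / (a * (1 - p) * p) * r) * (a * ((1 - p) * b / 4)) = 25 * (b * r) / p := by
    field_simp; ring
  refine le_trans ?_ (mul_le_mul_of_nonneg_left hx' (by positivity))
  rw [e, div_add' _ _ _ hp0.ne', div_le_div_iff_of_pos_right hp0]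
  linarith

/-- Both families of windows, of `n + 1` members each, contribute `4 n⁻³` per member to the
expected penalty. -/
theorem union_bound_le {n b : ℕ} {a p : ℝ} (h0 : 0 < a) (h1 : a < 1) (hp0 : 0 < p)
    (hp1 : p < 1) (hn : 3 ≤ n) (hb : 0 < b) (hbn : b ≤ n) :
    ((n : ℝ) + 1) * (8 * ((n : ℝ) ^ 3)⁻¹) ≤
      100 * (1 / (a * (1 - p) * p) * √(Real.log n / b)) := by
  have hn' : (3 : ℝ) ≤ n := by exact_mod_cast hn
  have hb' : (0 : ℝ) < b := by exact_mod_cast hb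
  have hp : 0 < 1 - p := by linarith
  have hr : 1 / (n : ℝ) ≤ √(Real.log n / b) := by
    refine Real.le_sqrt_of_sq_le ?_
    have : 1 / (n : ℝ) ≤ Real.log n / b :=
      div_le_div₀ (by linarith [one_le_log hn]) (one_le_log hn) hb' (by exact_mod_cast hbn)
    refine le_trans ?_ this
    rw [div_pow, one_pow]
    exact one_div_le_one_div_of_le (by linarith) (by nlinarith)
  have hd : a * (1 - p) * p ≤ 1 := by
    calc a * (1 - p) * p ≤ 1 * 1 * 1 := by gcongr; linarith
      _ = 1 := by ring
  have hd' : 1 ≤ 1 / (a * (1 - p) * p) := one_le_one_div (by positivity) hd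
  have h2 : 1 / (n : ℝ) ≤ 1 / (a * (1 - p) * p) * √(Real.log n / b) :=
    hr.trans (le_mul_of_one_le_left (Real.sqrt_nonneg _) hd')
  refine le_trans ?_ (mul_le_mul_of_nonneg_left h2 (by norm_num))
  rw [← mul_assoc, ← div_eq_mul_inv, mul_one_div, div_le_div_iff₀ (by positivity) (by positivity)]
  nlinarith [sq_nonneg (n : ℝ), mul_nonneg (by linarith : (0 : ℝ) ≤ n) (sq_nonneg (n : ℝ))]

theorem isCompetitive_alg {n b : ℕ} {a p : ℝ} (hn : 3 ≤ n) (hb : 0 < b) (hbn : b ≤ n)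
    (h0 : 0 < a) (h1 : a < 1) (hp0 : 0 < p) (hp1 : p < 1) :
    IsCompetitive n b a p (alg b a p) (p + (1 - p) / (2 - a) -
      200 * (1 / (a * (1 - p) * p) * √(Real.log n / b))) := by
  intro v
  have hb0 : (0 : ℝ) < b := by exact_mod_cast hb
  have hp : 0 < 1 - p := by linarith
  have hopt := opt_nonneg b h0 h1 v
  have hL := one_le_log hn
  have hub := union_bound_le h0 h1 hp0 hp1 hn hb hbn
  obtain ⟨-, -, hc⟩ := fixedThreshold_bounds h0 h1 hp1
  have hloss := fun x => additive_loss_le (b := b) (r := √(Real.log n / b)) (x := x) h0 h1 hp0 hp1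
    hb hL (by positivity) (by rw [Real.sq_sqrt (by positivity)]; field_simp)
  set r := √(Real.log n / b) with hr
  set ε := 1 / (a * (1 - p) * p) * r with hε
  have hr0 : 0 ≤ r := Real.sqrt_nonneg _
  have hε0 : 0 ≤ ε := by positivity
  -- if the error term is at least `1`, the claimed ratio is not positive
  rcases le_or_gt 1 (200 * ε) with hbig | hsmall
  · have h : 0 ≤ expect p v (alg b a p) := by
      have := avg_mono (n := n) hp0.le hp1.le (F := fun _ _ => 0)
        (G := fun S σ => alg b a p (arrival v S σ)) fun S σ => alg_nonneg b h0 p _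
      rwa [avg_const] at this
    nlinarith
  have hlog : Real.log n ≤ b := by
    have hrε : r ≤ ε := by
      refine le_mul_of_one_le_left hr0 (one_le_one_div (by positivity) ?_)
      calc a * (1 - p) * p ≤ 1 * 1 * 1 := by gcongr; linarith
        _ = 1 := by ring
    have : Real.log n / b ≤ 1 := Real.sqrt_le_one.1 (by linarith)
    rwa [div_le_one hb0] at this
  obtain ⟨T₁, hT₁, hT₁c⟩ := exists_subset_card_eq (min_le_right b (numType1 v))
  obtain ⟨T₂, hT₂, hT₂c⟩ := exists_subset_card_eq
    ((min_le_right b (numType1 v + numType2 v)).trans (card_filter_ne_none v).ge)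
  -- the sum of all penalties dominates the indicator of the bad event
  let B : (S : Finset (Fin n)) → Equiv.Perm {i // i ∈ S} → ℝ := fun S σ =>
    ∑ s ∈ range (n + 1), (penalty p b T₁ (initialPeriods n s) S σ +
      penalty p b T₂ (finalPeriods n s) S σ)
  have hB : avg p B ≤ 100 * ε := by
    refine le_trans ?_ hub
    rw [avg_sum]
    refine (sum_le_card_nsmul _ _ (8 * ((n : ℝ) ^ 3)⁻¹) fun s _ => ?_).trans_eq (by simp)
    rw [avg_add]
    have g1 := avg_penalty_le hp0.le hp1.le hb hbn hlog T₁ (initialPeriods n s)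
      (hT₁c.trans_le (min_le_left _ _))
    have g2 := avg_penalty_le hp0.le hp1.le hb hbn hlog T₂ (finalPeriods n s)
      (hT₂c.trans_le (min_le_left _ _))
    exact (add_le_add g1 g2).trans_eq (by ring)
  have hpoint : ∀ S σ, (p + (1 - p) / (2 - a) - 100 * ε) * opt b a v + -opt b a v * B S σ ≤
      alg b a p (arrival v S σ) := by
    intro S σ
    have hnn : ∀ s ∈ range (n + 1), 0 ≤ penalty p b T₁ (initialPeriods n s) S σ +
        penalty p b T₂ (finalPeriods n s) S σ := fun s _ =>
      add_nonneg (penalty_nonneg ..) (penalty_nonneg ..)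
    have hB0 : 0 ≤ B S σ := sum_nonneg hnn
    have hoB := mul_nonneg hopt hB0
    have hoε := mul_nonneg hε0 hopt
    rcases lt_or_ge (B S σ) 1 with hlt | hge
    · have hs : ∀ s ≤ n, penalty p b T₁ (initialPeriods n s) S σ < 1 ∧
          penalty p b T₂ (finalPeriods n s) S σ < 1 := fun s hs => by
        have g := (single_le_sum hnn (mem_range.2 (Nat.lt_succ_of_le hs))).trans_lt hlt
        have g1 := penalty_nonneg p b T₁ (initialPeriods n s) S σ
        have g2 := penalty_nonneg p b T₂ (finalPeriods n s) S σ
        exact ⟨by linarith, by linarith⟩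
      rcases revenue_of_penalty_lt_one h0 h1 hp0 hp1 hb hbn v
        (fun j hj => (mem_filter.1 (hT₁ hj)).2) hT₁c
        (fun j hj => (mem_filter.1 (hT₂ hj)).2) hT₂c S σ hs with g | ⟨g, g'⟩
      · linarith
      · have := hloss _ hsmall g
        linarith
    -- on the bad event the left-hand side is not positive
    · have g1 := alg_nonneg b h0 p (arrival v S σ)
      have g2 : 0 ≤ opt b a v * (B S σ - 1) := mul_nonneg hopt (by linarith)
      have g3 : 0 ≤ (1 - (p + (1 - p) / (2 - a))) * opt b a v := mul_nonneg (by linarith) hopt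
      linarith
  have hmain := avg_mono hp0.le hp1.le hpoint
  rw [avg_add, avg_const, avg_mul] at hmain
  change _ ≤ expect p v (alg b a p) at hmain
  have := mul_le_mul_of_nonneg_left hB hopt
  linarith

end PartiallyPredictable

theorem mainTheorem1 :
    ∃ K : ℝ, 0 < K ∧
      ∀ (n b : ℕ) (a p : ℝ), 3 ≤ n → 1 ≤ b → b ≤ n → 0 < a → a < 1 → 0 < p → p < 1 →
        PartiallyPredictable.IsCompetitive n b a p (PartiallyPredictable.alg b a p)
          (p + (1 - p) / (2 - a)
            - K * (1 / (a * (1 - p) * p) * Real.sqrt (Real.log n / b))) :=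
  ⟨200, by norm_num, fun _ _ _ _ hn hb hbn h0 h1 hp0 hp1 =>
    PartiallyPredictable.isCompetitive_alg hn hb hbn h0 h1 hp0 hp1⟩
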